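/- Let $G$ be a finite, simple, connected graph with $n$ vertices that contains a cycle, and let $g(G)$ be its girth, i.e. the length of a shortest cycle in $G$. A set $W\subseteq V(G)$ is a resolving set for $G$ if for any two distinct vertices $u,v$ of $G$ there is $w\in W$ with $d(u,w)\neq d(v,w)$, where $d$ is the graph distance; the metric dimension $\beta(G)$ is the minimum cardinality of a resolving set for $G$. Then $$\beta(G)=n-g(G)+2$$ if and only if $G$ is a cycle $C_n$ with $n\geq 3$, a complete graph $K_n$ with $n\geq 3$, or a complete bipartite graph $K_{r,s}$ with $r,s\geq 2$ (up to isomorphism). -/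

import Mathlib

namespace SimpleGraph

/-- A set `W` of vertices is a resolving set for `G` if any two distinct vertices are at different
distances from some vertex of `W`, i.e. have different metric representations with respect to `W`.
The distance `SimpleGraph.dist` is the length of a shortest path between vertices of a connected
graph; this notion is meant for connected graphs. -/
def IsResolvingSet {V : Type*} (G : SimpleGraph V) (W : Set V) : Prop :=
  ∀ u v : V, u ≠ v → ∃ w ∈ W, G.dist u w ≠ G.dist v w

/-- The whole vertex set of a connected graph is resolving, so resolving sets exist. -/
theorem Connected.isResolvingSet_univ {V : Type*} {G : SimpleGraph V} (hG : G.Connected) :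
    G.IsResolvingSet Set.univ := by
  intro u v huv
  refine ⟨u, Set.mem_univ u, ?_⟩
  rw [dist_self]
  exact (hG.pos_dist_of_ne huv.symm).ne

/-- The metric dimension of a finite connected graph: the minimum cardinality of a resolving
set. -/
noncomputable def metricDimension {V : Type*} [Fintype V] (G : SimpleGraph V) : ℕ :=
  sInf {k : ℕ | ∃ W : Finset V, G.IsResolvingSet (W : Set V) ∧ W.card = k}

/-- The minimum is attained for every finite connected graph. -/
theorem Connected.exists_card_eq_metricDimension {V : Type*} [Fintype V] {G : SimpleGraph V}
    (hG : G.Connected) :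
    ∃ W : Finset V, G.IsResolvingSet (W : Set V) ∧ W.card = G.metricDimension :=
  Nat.sInf_mem (s := {k : ℕ | ∃ W : Finset V, G.IsResolvingSet (W : Set V) ∧ W.card = k})
    ⟨_, Finset.univ, by simpa using hG.isResolvingSet_univ, rfl⟩

end SimpleGraph

/-!
Let `n` be the number of vertices, `g` the girth and `β` the metric dimension.

A shortest cycle is isometric (`Walk.IsCycle.dist_getVert`), because two distinct paths with common
endpoints and total length less than `g` would enclose a shorter cycle. Distances on a cycle are thus
known, and two adjacent vertices of the cycle resolve all of it. Dropping the other `g - 2` vertices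
of the cycle from the vertex set gives `β ≤ n - g + 2`
(`Connected.metricDimension_add_girth_le`). Equality means that no larger set of vertices can be
dropped:

* if a shortest cycle is spanning, it has no chord and `G` is a cycle;
* if `g = 3`, then `β = n - 1`, which forces `G` to be complete;
* if `g = 4`, then `β = n - 2`; the diameter is at most two, and if non-adjacency were not transitive,
  there would be an induced five-cycle, three of whose vertices can be dropped
  (`Connected.not_adj_trans`). So `G` is complete multipartite and triangle-free, i.e. complete
  bipartite;
* if `g ≥ 5`, then a vertex off the cycle but adjacent to it would allow one more to be dropped
  (`Connected.metricDimension_add_girth_le_of_notMem`).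

Conversely, by the upper bound it is enough to bound `β` and `g` from below. In complete and
complete bipartite graphs a resolving set contains one of any two twins
(`Connected.mem_or_mem_of_twins`), whence `β ≥ n - 1` and `β ≥ n - 2`. A cycle has `β ≥ 2` since no
vertex resolves its two neighbours, and `g = n` since its vertices have degree two.
-/

namespace SimpleGraph

variable {V : Type*} {G : SimpleGraph V}

/-! ### Shortest cycles -/

/-- Two distinct paths with the same endpoints contain a cycle in their union. -/
theorem Walk.IsPath.girth_le_length_add_length {u v : V} {p q : G.Walk u v} (hp : p.IsPath)
    (hq : q.IsPath) (hne : p ≠ q) : G.girth ≤ p.length + q.length := by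
  classical
  induction p with
  | nil => exact absurd (Walk.isPath_iff_nil.mp hq).eq_nil.symm hne
  | @cons u a v h p ih =>
    obtain ⟨hp, hu⟩ := (Walk.cons_isPath_iff h p).mp hp
    by_cases hmem : s(u, a) ∈ q.edges
    -- The first edge of `p` can only be the first edge of `q`, so both paths can be shortened.
    · cases q with
      | nil => simp at hmem
      | @cons _ b _ h' q =>
        obtain rfl : a = b := by simpa using hq.eq_snd_of_mem_edges hmem
        have := ih hp ((Walk.cons_isPath_iff h' q).mp hq).1 (fun e ↦ hne (e ▸ rfl))
        simp only [Walk.length_cons]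
        omega
    -- The rest of `p` followed by `q` backwards avoids that edge, which therefore closes a cycle.
    · have hcyc : (Walk.cons h (p.append q.reverse).bypass).IsCycle := by
        refine (Walk.cons_isCycle_iff _ h).mpr ⟨Walk.bypass_isPath _, fun hin ↦ ?_⟩
        have := Walk.edges_bypass_subset_edges _ hin
        rw [Walk.edges_append, Walk.edges_reverse, List.mem_append, List.mem_reverse] at this
        exact this.elim (fun h ↦ hu (p.fst_mem_support_of_mem_edges h)) hmem
      have h₁ := girth_le_length hcyc
      have h₂ := Walk.length_bypass_le_length (p.append q.reverse)
      simp only [Walk.length_cons, Walk.length_append, Walk.length_reverse] at *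
      omega

theorem Adj.girth_le_three {a b c : V} (hab : G.Adj a b) (hbc : G.Adj b c) (hac : G.Adj a c) :
    G.girth ≤ 3 :=
  Walk.IsPath.girth_le_length_add_length (p := hac.toWalk) (q := .cons hab hbc.toWalk)
    (by simp [hac.ne]) (by simp [hab.ne, hac.ne, hbc.ne]) (fun h ↦ by
      simpa using congrArg Walk.length h)

/-- Without triangles and four-cycles, two vertices have at most one common neighbour. -/
theorem eq_of_adj_of_adj_of_four_lt_girth (hg : 4 < G.girth) {a b x y : V} (hab : a ≠ b)
    (hxa : G.Adj x a) (hxb : G.Adj x b) (hya : G.Adj y a) (hyb : G.Adj y b) : x = y := by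
  by_contra hxy
  have := Walk.IsPath.girth_le_length_add_length (p := .cons hxa.symm hxb.toWalk)
    (q := .cons hya.symm hyb.toWalk) (by simp [hxa.ne', hxb.ne, hab])
    (by simp [hya.ne', hyb.ne, hab]) (fun h ↦ hxy (by simpa using congrArg Walk.snd h))
  simp at this
  omega

/-- The arc of a cycle between two positions. It is a path unless it runs once around the whole cycle. -/
theorem Walk.IsCycle.exists_isPath_getVert {u : V} {c : G.Walk u u} (hc : c.IsCycle) {i j : ℕ}
    (hij : i ≤ j) (hj : j ≤ c.length) (hlt : j - i < c.length) :
    ∃ p : G.Walk (c.getVert i) (c.getVert j), p.IsPath ∧ p.length = j - i := by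
  obtain rfl | hi := Nat.eq_zero_or_pos i
  · exact ⟨(c.take j).copy (c.getVert_zero).symm rfl, by
      simpa using hc.isPath_take (by omega), by simp; omega⟩
  · refine ⟨((c.drop i).take (j - i)).copy rfl (by rw [Walk.drop_getVert]; congr 1; omega), ?_, ?_⟩
    · simpa using (hc.isPath_drop hi).take _
    · simp; omega

/-- A shortest cycle is isometric: a shortcut between two of its vertices would form a shorter
cycle together with one of the two arcs. -/
theorem Walk.IsCycle.dist_getVert {u : V} {c : G.Walk u u} (hc : c.IsCycle)
    (hg : c.length = G.girth) {i j : ℕ} (hij : i ≤ j) (hj : j ≤ c.length) :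
    G.dist (c.getVert i) (c.getVert j) = min (j - i) (c.length - (j - i)) := by
  obtain hlt | heq : j - i < c.length ∨ j - i = c.length := by omega
  · obtain ⟨q, hq, hql⟩ := hc.exists_isPath_getVert hij hj hlt
    obtain ⟨p, hp, hpl⟩ := q.reachable.exists_path_of_dist
    have h₁ : G.dist (c.getVert i) (c.getVert j) ≤ c.length - (j - i) := by
      rw [dist_comm]
      refine (dist_le ((c.drop j).append (c.take i))).trans ?_
      simp
      omega
    have h₂ := dist_le q
    by_cases hpq : p = q
    · subst hpq
      omega
    · have := hp.girth_le_length_add_length hq hpq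
      omega
  · obtain ⟨rfl, rfl⟩ : i = 0 ∧ j = c.length := by omega
    simp

theorem Walk.IsCycle.adj_getVert_iff {u : V} {c : G.Walk u u} (hc : c.IsCycle)
    (hg : c.length = G.girth) {i j : ℕ} (hij : i ≤ j) (hj : j < c.length) :
    G.Adj (c.getVert i) (c.getVert j) ↔ j = i + 1 ∨ i = 0 ∧ j + 1 = c.length := by
  have := hc.three_le_length
  rw [← dist_eq_one_iff_adj, hc.dist_getVert hg hij hj.le]
  omega

theorem Walk.IsCycle.getVert_inj_of_lt {u : V} {c : G.Walk u u} (hc : c.IsCycle) {i j : ℕ}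
    (hi : i < c.length) (hj : j < c.length) : c.getVert i = c.getVert j ↔ i = j :=
  ⟨fun h ↦ hc.getVert_injOn' (by simp; omega) (by simp; omega) h, fun h ↦ by rw [h]⟩

/-- Two adjacent vertices of a shortest cycle resolve all its vertices. -/
theorem Walk.IsCycle.dist_zero_ne_or_dist_one_ne {u : V} {c : G.Walk u u} (hc : c.IsCycle)
    (hg : c.length = G.girth) {i j : ℕ} (hi : i < c.length) (hj : j < c.length) (hij : i ≠ j) :
    G.dist (c.getVert i) (c.getVert 0) ≠ G.dist (c.getVert j) (c.getVert 0) ∨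
      G.dist (c.getVert i) (c.getVert 1) ≠ G.dist (c.getVert j) (c.getVert 1) := by
  have := hc.three_le_length
  have hd : ∀ k < c.length, G.dist (c.getVert k) (c.getVert 0) = min k (c.length - k) ∧
      G.dist (c.getVert k) (c.getVert 1) =
        if k = 0 then 1 else min (k - 1) (c.length - (k - 1)) := by
    intro k hk
    refine ⟨by rw [dist_comm, hc.dist_getVert hg k.zero_le hk.le]; rfl, ?_⟩
    split_ifs with h
    · rw [h, hc.dist_getVert hg zero_le_one (by omega)]
      omega
    · rw [dist_comm, hc.dist_getVert hg (by omega) hk.le]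
  obtain ⟨h₁, h₂⟩ := hd i hi
  obtain ⟨h₃, h₄⟩ := hd j hj
  rw [h₁, h₂, h₃, h₄]
  split_ifs <;> omega

/-- A shortest cycle, based at a vertex with a neighbour off the cycle unless it is spanning. -/
theorem Connected.exists_girth_cycle (hG : G.Connected)
    (hcyc : ∃ (v : V) (c : G.Walk v v), c.IsCycle) :
    ∃ (v : V) (c : G.Walk v v), c.IsCycle ∧ c.length = G.girth ∧
      ((∀ x, x ∈ c.support) ∨ ∃ x ∉ c.support, G.Adj v x) := by
  classical
  obtain ⟨v, c, hc, hg⟩ := exists_girth_eq_length.mpr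
    (fun h : G.IsAcyclic ↦ hcyc.elim fun v ⟨c, hc⟩ ↦ h c hc)
  by_cases hall : ∀ x, x ∈ c.support
  · exact ⟨v, c, hc, hg.symm, .inl hall⟩
  · push Not at hall
    obtain ⟨x, hx⟩ := hall
    obtain ⟨d, -, h₁, h₂⟩ := (hG v x).some.exists_boundary_dart {y | y ∈ c.support} (by simp) hx
    refine ⟨d.fst, c.rotate _ h₁, hc.rotate h₁, by simp [hg], .inr ⟨d.snd, ?_, d.adj⟩⟩
    simpa using h₂

/-- A spanning shortest cycle is chordless, hence is the whole graph. -/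
theorem Walk.IsCycle.nonempty_iso_cycleGraph [Fintype V] {u : V} {c : G.Walk u u}
    (hc : c.IsCycle) (hg : c.length = G.girth) (hall : ∀ x, x ∈ c.support) :
    Nonempty (G ≃g cycleGraph (Fintype.card V)) := by
  classical
  have hl := hc.three_le_length
  have hbij : Function.Bijective (fun i : Fin c.length ↦ c.getVert i) := by
    refine ⟨fun i j h ↦ Fin.ext ((hc.getVert_inj_of_lt i.2 j.2).mp h), fun x ↦ ?_⟩
    obtain ⟨k, rfl, hk⟩ := Walk.mem_support_iff_exists_getVert.mp (hall x)
    obtain hk | rfl := hk.lt_or_eq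
    · exact ⟨⟨k, hk⟩, rfl⟩
    · exact ⟨⟨0, by omega⟩, by simp⟩
  have hcard : Fintype.card V = c.length := by
    simpa using (Fintype.card_of_bijective hbij).symm
  rw [hcard]
  have key : ∀ i j : Fin c.length, i ≤ j →
      (G.Adj (c.getVert i) (c.getVert j) ↔ (cycleGraph c.length).Adj i j) := by
    intro i j hij
    have h₁ := Fin.sub_val_of_le hij
    have h₂ : (i - j).val = if i = j then 0 else c.length - (j.val - i.val) := by
      split_ifs with h
      · subst h
        exact (Fin.sub_val_of_le le_rfl).trans (by simp)
      · have : i < j := lt_of_le_of_ne hij h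
        rw [Fin.coe_sub_iff_lt.mpr this]
        omega
    rw [hc.adj_getVert_iff hg hij j.2, cycleGraph_adj', h₁, h₂]
    have := j.2
    have : i.val ≤ j.val := hij
    split_ifs with h
    · subst h
      simp only [false_or]
      omega
    · have : i.val ≠ j.val := fun e ↦ h (Fin.ext e)
      omega
  refine ⟨(show cycleGraph c.length ≃g G from ⟨Equiv.ofBijective _ hbij, fun {i j} ↦ ?_⟩).symm⟩
  rcases le_total i j with h | h
  · exact key i j h
  · simpa only [Equiv.ofBijective_apply, adj_comm] using key j i h

theorem Walk.IsCycle.adj_start_getVert_iff {u : V} {c : G.Walk u u} (hc : c.IsCycle)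
    (hg : c.length = G.girth) {j : ℕ} (hj : j < c.length) :
    G.Adj u (c.getVert j) ↔ j = 1 ∨ j + 1 = c.length := by
  have := hc.adj_getVert_iff hg j.zero_le hj
  rw [c.getVert_zero] at this
  rw [this]
  omega

/-! ### Bounding the metric dimension -/

/-- The vertices in `T` can be dropped from the full resolving set as soon as vertices outside `T`
resolve them from each other, because a landmark is resolved from everything else by itself. -/
theorem metricDimension_add_card_le [Fintype V] (hG : G.Connected) (T : Finset V)
    (hT : ∀ u ∈ T, ∀ v ∈ T, u ≠ v → ∃ w ∉ T, G.dist u w ≠ G.dist v w) :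
    G.metricDimension + T.card ≤ Fintype.card V := by
  classical
  have hres : G.IsResolvingSet ((Tᶜ : Finset V) : Set V) := by
    intro u v huv
    by_cases hu : u ∈ T
    · by_cases hv : v ∈ T
      · obtain ⟨w, hw, h⟩ := hT u hu v hv huv
        exact ⟨w, by simpa using hw, h⟩
      · refine ⟨v, by simpa using hv, ?_⟩
        rw [dist_self]
        exact (hG.pos_dist_of_ne huv).ne'
    · refine ⟨u, by simpa using hu, ?_⟩
      rw [dist_self]
      exact (hG.pos_dist_of_ne huv.symm).ne
  have h : G.metricDimension ≤ (Tᶜ).card := Nat.sInf_le ⟨_, hres, rfl⟩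
  have := T.card_add_card_compl
  omega

theorem le_metricDimension [Fintype V] (hG : G.Connected) {k : ℕ}
    (h : ∀ W : Finset V, G.IsResolvingSet (W : Set V) → k ≤ W.card) : k ≤ G.metricDimension := by
  obtain ⟨W, hW, hk⟩ := hG.exists_card_eq_metricDimension
  exact hk ▸ h W hW

theorem Walk.IsCycle.injOn_getVert_Ico {u : V} {c : G.Walk u u} (hc : c.IsCycle) (k : ℕ) :
    Set.InjOn c.getVert (Finset.Ico k c.length : Finset ℕ) := fun i hi j hj h ↦ by
  simp only [Finset.coe_Ico, Set.mem_Ico] at hi hj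
  exact (hc.getVert_inj_of_lt hi.2 hj.2).mp h

/-- The upper bound `β(G) ≤ n - g(G) + 2`: all vertices off a shortest cycle and two adjacent ones
on it form a resolving set. -/
theorem Connected.metricDimension_add_girth_le [Fintype V] (hG : G.Connected)
    (hcyc : ∃ (v : V) (c : G.Walk v v), c.IsCycle) :
    G.metricDimension + G.girth ≤ Fintype.card V + 2 := by
  classical
  obtain ⟨v, c, hc, hg, -⟩ := hG.exists_girth_cycle hcyc
  have hl := hc.three_le_length
  have hnot : ∀ k < 2, c.getVert k ∉ (Finset.Ico 2 c.length).image c.getVert := by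
    intro k hk hmem
    obtain ⟨i, hi, he⟩ := Finset.mem_image.mp hmem
    rw [Finset.mem_Ico] at hi
    have := (hc.getVert_inj_of_lt hi.2 (by omega)).mp he
    omega
  have := metricDimension_add_card_le hG ((Finset.Ico 2 c.length).image c.getVert) (by
    intro a ha b hb hab
    obtain ⟨i, hi, rfl⟩ := Finset.mem_image.mp ha
    obtain ⟨j, hj, rfl⟩ := Finset.mem_image.mp hb
    rw [Finset.mem_Ico] at hi hj
    rcases hc.dist_zero_ne_or_dist_one_ne hg hi.2 hj.2 (fun h ↦ hab (by rw [h])) with h | h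
    · exact ⟨_, hnot 0 (by omega), h⟩
    · exact ⟨_, hnot 1 (by omega), h⟩)
  rw [Finset.card_image_of_injOn (hc.injOn_getVert_Ico 2), Nat.card_Ico] at this
  omega

/-! ### Girth at least five -/

/-- Every path to a leaf `x` runs through its neighbour `u`. -/
theorem Connected.dist_eq_of_forall_adj_eq (hG : G.Connected) {x u : V} (h : ∀ y, G.Adj x y → y = u)
    {w : V} (hw : w ≠ x) (hxu : G.Adj x u) : G.dist w x = G.dist w u + 1 := by
  refine le_antisymm ?_ ?_
  · have := hG.dist_triangle (u := w) (v := u) (w := x)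
    rwa [dist_eq_one_iff_adj.mpr hxu.symm] at this
  · obtain ⟨p, hp⟩ := hG.exists_walk_length_eq_dist x w
    cases p with
    | nil => exact absurd rfl hw
    | cons hxa p =>
      obtain rfl := h _ hxa
      have := dist_le p
      rw [dist_comm (u := w), dist_comm (u := w), ← hp, Walk.length_cons]
      omega

/-- For girth at least five the upper bound `n - g + 2` is not attained when the shortest cycle has a
vertex `x` off it. With `x` adjacent to the vertex `u` of the cycle, the landmarks `u` and its
successor confuse `x` only with the predecessor of `u`; a second neighbour of `x` resolves this pair.
If there is none, `x` is a leaf and serves as a landmark in place of `u`. -/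
theorem Connected.metricDimension_add_girth_le_of_notMem [Fintype V] (hG : G.Connected)
    (h5 : 4 < G.girth) {u : V} {c : G.Walk u u} (hc : c.IsCycle) (hg : c.length = G.girth) {x : V}
    (hx : x ∉ c.support) (hux : G.Adj u x) :
    G.metricDimension + G.girth ≤ Fintype.card V + 1 := by
  classical
  have hxc : ∀ i, c.getVert i ≠ x := fun i h ↦ hx (h ▸ c.getVert_mem_support i)
  have hnot : ∀ k j, k < j → j ≤ c.length → ∀ i ∈ Finset.Ico j c.length,
      c.getVert i ≠ c.getVert k := by
    intro k j hk hj i hi he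
    rw [Finset.mem_Ico] at hi
    have := (hc.getVert_inj_of_lt hi.2 (by omega)).mp he
    omega
  have hu1 : G.Adj u (c.getVert 1) :=
    (hc.adj_start_getVert_iff hg (by omega)).mpr (.inl rfl)
  set P := (Finset.Ico 2 c.length).image c.getVert with hP
  have hPcard : P.card = c.length - 2 := by
    rw [hP, Finset.card_image_of_injOn (hc.injOn_getVert_Ico 2), Nat.card_Ico]
  have h0P : u ∉ P := fun h ↦ by
    obtain ⟨i, hi, he⟩ := Finset.mem_image.mp h
    exact hnot 0 2 (by omega) (by omega) i hi (he.trans c.getVert_zero.symm)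
  have h1P : c.getVert 1 ∉ P := fun h ↦ by
    obtain ⟨i, hi, he⟩ := Finset.mem_image.mp h
    exact hnot 1 2 (by omega) (by omega) i hi he
  have hxP : x ∉ P := fun h ↦ by
    obtain ⟨i, hi, he⟩ := Finset.mem_image.mp h
    exact hxc i he
  by_cases hdeg : ∀ y, G.Adj x y → y = u
  -- `x` is a leaf, hence can replace its neighbour `u` as a landmark.
  · have := metricDimension_add_card_le hG (insert u P) (by
      have hmem : ∀ a ∈ insert u P, ∃ i < c.length, c.getVert i = a := by
        intro a ha
        rcases Finset.mem_insert.mp ha with rfl | ha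
        · exact ⟨0, by omega, c.getVert_zero⟩
        · obtain ⟨i, hi, rfl⟩ := Finset.mem_image.mp ha
          exact ⟨i, (Finset.mem_Ico.mp hi).2, rfl⟩
      intro a ha b hb hab
      obtain ⟨i, hi, rfl⟩ := hmem a ha
      obtain ⟨j, hj, rfl⟩ := hmem b hb
      rcases hc.dist_zero_ne_or_dist_one_ne hg hi hj (fun h ↦ hab (by rw [h])) with h | h
      · rw [c.getVert_zero] at h
        refine ⟨x, by simp [hxP, hux.ne'], ?_⟩
        rw [hG.dist_eq_of_forall_adj_eq hdeg (hxc i) hux.symm,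
          hG.dist_eq_of_forall_adj_eq hdeg (hxc j) hux.symm]
        omega
      · exact ⟨_, by simp [h1P, hu1.ne'], h⟩)
    rw [Finset.card_insert_of_notMem h0P] at this
    omega
  · push Not at hdeg
    obtain ⟨y, hxy, hyu⟩ := hdeg
    have hyP : y ∉ P := fun h ↦ by
      obtain ⟨i, hi, rfl⟩ := Finset.mem_image.mp h
      rw [Finset.mem_Ico] at hi
      -- A vertex adjacent to both `u` and `y` must be `x`, so `y` is not at distance two from `u`
      -- along the cycle.
      have hcommon : ∀ k, G.Adj u (c.getVert k) → ¬ G.Adj (c.getVert k) (c.getVert i) :=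
        fun k h₁ h₂ ↦ hxc k (eq_of_adj_of_adj_of_four_lt_girth h5 hyu.symm h₁.symm h₂ hux.symm hxy)
      have hd := hc.dist_getVert hg i.zero_le hi.2.le
      have hle : G.dist u (c.getVert i) ≤ 2 := dist_le (.cons hux hxy.toWalk)
      rw [c.getVert_zero] at hd
      obtain rfl | h' | h' : i = 2 ∨ i + 1 = c.length ∨ i + 2 = c.length := by omega
      · exact hcommon 1 hu1 ((hc.adj_getVert_iff hg (by omega) hi.2).mpr (by omega))
      · have := hux.girth_le_three hxy
          ((hc.adj_start_getVert_iff hg hi.2).mpr (.inr h'))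
        omega
      · exact hcommon (i + 1)
          ((hc.adj_start_getVert_iff hg (by omega)).mpr (by omega))
          ((hc.adj_getVert_iff hg (by omega) (by omega)).mpr (by omega)).symm
    have hsep : ∀ i ∈ Finset.Ico 2 c.length, ∃ w ∉ insert x P,
        (G.dist x w = 1 ↔ G.dist (c.getVert i) w ≠ 1) := by
      intro i hi
      rw [Finset.mem_Ico] at hi
      by_cases hiu : G.Adj (c.getVert i) u
      -- If `y` were adjacent to `c.getVert i`, there would be a four-cycle `x, u, c.getVert i, y`.
      · refine ⟨y, by simp [hxy.ne', hyP], ?_⟩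
        have : ¬ G.Adj (c.getVert i) y := fun h ↦
          hxc i (eq_of_adj_of_adj_of_four_lt_girth h5 hyu.symm hiu h hux.symm hxy)
        simp [dist_eq_one_iff_adj, hxy, this]
      · exact ⟨u, by simp [hux.ne, h0P], by simp [dist_eq_one_iff_adj, hux.symm, hiu]⟩
    have := metricDimension_add_card_le hG (insert x P) (by
      intro a ha b hb hab
      rcases Finset.mem_insert.mp ha with ha' | ha' <;>
        rcases Finset.mem_insert.mp hb with hb' | hb'
      · exact absurd (ha'.trans hb'.symm) hab
      · subst ha'
        obtain ⟨i, hi, rfl⟩ := Finset.mem_image.mp hb'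
        obtain ⟨w, hw, h⟩ := hsep i hi
        exact ⟨w, hw, by omega⟩
      · subst hb'
        obtain ⟨i, hi, rfl⟩ := Finset.mem_image.mp ha'
        obtain ⟨w, hw, h⟩ := hsep i hi
        exact ⟨w, hw, by omega⟩
      · obtain ⟨i, hi, rfl⟩ := Finset.mem_image.mp ha'
        obtain ⟨j, hj, rfl⟩ := Finset.mem_image.mp hb'
        rw [Finset.mem_Ico] at hi hj
        rcases hc.dist_zero_ne_or_dist_one_ne hg hi.2 hj.2 (fun h ↦ hab (by rw [h])) with h | h
        · rw [c.getVert_zero] at h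
          exact ⟨u, by simp [hux.ne, h0P], h⟩
        · exact ⟨_, by simp [hxc 1, h1P], h⟩)
    rw [Finset.card_insert_of_notMem hxP] at this
    omega

/-! ### Girth three and four -/

theorem dist_ne_of_adj_of_not_adj {u v w : V} (hu : G.Adj u w) (hv : ¬ G.Adj v w) :
    G.dist u w ≠ G.dist v w := by
  rw [← dist_eq_one_iff_adj] at hu hv
  omega

/-- An induced path `x, y, z` lets both `y` and `z` be dropped, since `x` resolves them. -/
theorem Connected.eq_top_of_card_lt_metricDimension_add_two [Fintype V] (hG : G.Connected)
    (h : Fintype.card V < G.metricDimension + 2) : G = ⊤ := by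
  classical
  by_contra hne
  obtain ⟨a, b, hab, hnadj⟩ := ne_top_iff_exists_not_adj.mp hne
  obtain ⟨p, hp⟩ := hG.exists_walk_length_eq_dist a b
  obtain ⟨x, y, z, hxy, hyz, hxz, hxz'⟩ :=
    p.exists_adj_adj_not_adj_ne hp (hG.one_lt_dist_of_ne_of_not_adj hab hnadj)
  have hsep := dist_ne_of_adj_of_not_adj hxy.symm (fun h ↦ hxz h.symm)
  have := metricDimension_add_card_le hG {y, z} (by
    have : x ∉ ({y, z} : Finset V) := by simp [hxy.ne, hxz']
    intro u hu v hv huv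
    simp only [Finset.mem_insert, Finset.mem_singleton] at hu hv
    rcases hu with rfl | rfl <;> rcases hv with rfl | rfl
    · exact absurd rfl huv
    · exact ⟨x, this, hsep⟩
    · exact ⟨x, this, hsep.symm⟩
    · exact absurd rfl huv)
  rw [Finset.card_pair hyz.ne] at this
  omega

/-- If `β(G) ≥ n - 2`, the diameter is at most two: on a geodesic of length three or more, the first
vertex resolves the next three. -/
theorem Connected.exists_adj_adj_of_not_adj [Fintype V] (hG : G.Connected)
    (h : Fintype.card V < G.metricDimension + 3) {u v : V} (huv : u ≠ v) (hadj : ¬ G.Adj u v) :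
    ∃ w, G.Adj u w ∧ G.Adj v w := by
  classical
  by_contra! hno
  obtain ⟨p, hp⟩ := hG.exists_walk_length_eq_dist u v
  have h1 := hG.one_lt_dist_of_ne_of_not_adj huv hadj
  have hd : ∀ i ≤ p.length, G.dist (p.getVert i) u = i := by
    intro i hi
    rw [dist_comm, ← length_eq_dist_of_subwalk hp (p.isSubwalk_take i), Walk.take_length]
    omega
  have h3 : 3 ≤ p.length := by
    by_contra hlt
    have h2 : p.length = 2 := by omega
    have ha := p.adj_getVert_succ (i := 0) (by omega)
    have hb := p.adj_getVert_succ (i := 1) (by omega)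
    rw [p.getVert_zero] at ha
    rw [p.getVert_of_length_le (i := 1 + 1) (by omega)] at hb
    exact hno _ ha hb.symm
  have hmem : ∀ a ∈ (Finset.Icc 1 3).image p.getVert, ∃ i ∈ Finset.Icc 1 3, p.getVert i = a :=
    fun a ↦ Finset.mem_image.mp
  have := metricDimension_add_card_le hG ((Finset.Icc 1 3).image p.getVert) (by
    intro a ha b hb hab
    obtain ⟨i, hi, rfl⟩ := hmem a ha
    obtain ⟨j, hj, rfl⟩ := hmem b hb
    rw [Finset.mem_Icc] at hi hj
    refine ⟨u, fun hu ↦ ?_, ?_⟩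
    · obtain ⟨k, hk, he⟩ := hmem u hu
      rw [Finset.mem_Icc] at hk
      have := hd k (by omega)
      rw [he, dist_self] at this
      omega
    · rw [hd i (by omega), hd j (by omega)]
      exact fun h ↦ hab (by rw [h]))
  rw [Finset.card_image_of_injOn, Nat.card_Icc] at this
  · omega
  · intro i hi j hj hij
    simp only [Finset.coe_Icc, Set.mem_Icc] at hi hj
    rw [← hd i (by omega), ← hd j (by omega), hij]

/-- If a triangle-free graph has `β(G) ≥ n - 2`, then non-adjacency is transitive. Otherwise, as the
diameter is at most two, `x, z` and `y` lie on an induced five-cycle `x, z, b, y, a`, and its adjacent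
vertices `y, a` resolve the other three. -/
theorem Connected.not_adj_trans [Fintype V] (hG : G.Connected)
    (h : Fintype.card V < G.metricDimension + 3) (hg : 3 < G.girth) {x y z : V}
    (hxy : ¬ G.Adj x y) (hyz : ¬ G.Adj y z) : ¬ G.Adj x z := by
  classical
  intro hxz
  have htri : ∀ {a b c : V}, G.Adj a b → G.Adj b c → ¬ G.Adj a c := fun h₁ h₂ h₃ ↦
    (h₁.girth_le_three h₂ h₃).not_gt hg
  have hxy' : x ≠ y := by rintro rfl; exact hyz hxz
  have hyz' : y ≠ z := by rintro rfl; exact hxy hxz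
  obtain ⟨a, hxa, hya⟩ := hG.exists_adj_adj_of_not_adj h hxy' hxy
  obtain ⟨b, hyb, hzb⟩ := hG.exists_adj_adj_of_not_adj h hyz' hyz
  have haz : ¬ G.Adj z a := fun h ↦ htri hxz h hxa
  have hab : ¬ G.Adj b a := fun h ↦ htri hyb h hya
  have hxb : ¬ G.Adj x b := fun h ↦ htri hxz hzb h
  have hxb' : x ≠ b := by rintro rfl; exact hxy hyb.symm
  have hza' : a ≠ z := by rintro rfl; exact hyz hya
  have hab' : a ≠ b := by rintro rfl; exact haz hzb
  have hyT : y ∉ ({x, z, b} : Finset V) := by simp [hxy'.symm, hyz', hyb.ne]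
  have haT : a ∉ ({x, z, b} : Finset V) := by simp [hxa.ne', hza', hab']
  have := metricDimension_add_card_le hG {x, z, b} (by
    intro u hu v hv huv
    simp only [Finset.mem_insert, Finset.mem_singleton] at hu hv
    rcases hu with rfl | rfl | rfl <;> rcases hv with rfl | rfl | rfl
    · exact absurd rfl huv
    · exact ⟨a, haT, dist_ne_of_adj_of_not_adj hxa haz⟩
    · exact ⟨a, haT, dist_ne_of_adj_of_not_adj hxa hab⟩
    · exact ⟨a, haT, (dist_ne_of_adj_of_not_adj hxa haz).symm⟩
    · exact absurd rfl huv
    · exact ⟨y, hyT, (dist_ne_of_adj_of_not_adj hyb.symm fun h ↦ hyz h.symm).symm⟩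
    · exact ⟨a, haT, (dist_ne_of_adj_of_not_adj hxa hab).symm⟩
    · exact ⟨y, hyT, dist_ne_of_adj_of_not_adj hyb.symm fun h ↦ hyz h.symm⟩
    · exact absurd rfl huv)
  rw [Finset.card_eq_three.mpr ⟨x, z, b, hxz.ne, hxb', hzb.ne, rfl⟩] at this
  omega

/-- The two sides are the neighbours and the non-neighbours (including `v`) of the vertex `v`. -/
theorem nonempty_iso_completeBipartiteGraph [Fintype V] (hg : 3 < G.girth)
    (htrans : ∀ x y z, ¬ G.Adj x y → ¬ G.Adj y z → ¬ G.Adj x z) {v a b d : V}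
    (ha : G.Adj v a) (hb : G.Adj v b) (hab : a ≠ b) (hd : ¬ G.Adj v d) (hvd : v ≠ d) :
    ∃ r s : ℕ, 2 ≤ r ∧ 2 ≤ s ∧ Nonempty (G ≃g completeBipartiteGraph (Fin r) (Fin s)) := by
  classical
  have hmid : ∀ x y, G.Adj v x → G.Adj v y → ¬ G.Adj x y := fun x y h₁ h₂ h₃ ↦
    (h₁.girth_le_three h₃ h₂).not_gt hg
  have hfar : ∀ x y, ¬ G.Adj v x → ¬ G.Adj v y → ¬ G.Adj x y := fun x y h₁ h₂ ↦
    htrans x v y (fun h ↦ h₁ h.symm) h₂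
  have hcross : ∀ x y, G.Adj v x → ¬ G.Adj v y → G.Adj x y := fun x y h₁ h₂ ↦ by
    by_contra h
    exact htrans v y x h₂ (fun h' ↦ h h'.symm) h₁
  let e := Equiv.sumCompl (fun x ↦ G.Adj v x)
  let e' := e.symm.trans (Equiv.sumCongr (Fintype.equivFin _) (Fintype.equivFin _))
  refine ⟨Fintype.card {x // G.Adj v x}, Fintype.card {x // ¬ G.Adj v x},
    Fintype.one_lt_card_iff.mpr ⟨⟨a, ha⟩, ⟨b, hb⟩, by simpa using hab⟩,
    Fintype.one_lt_card_iff.mpr ⟨⟨v, G.irrefl⟩, ⟨d, hd⟩, by simpa using hvd⟩, ⟨?_⟩⟩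
  refine (show completeBipartiteGraph _ _ ≃g G from ⟨e'.symm, fun {x y} ↦ ?_⟩).symm
  have hN : ∀ x : {x // G.Adj v x}, G.Adj v x := Subtype.prop
  have hN' : ∀ x : {x // ¬ G.Adj v x}, ¬ G.Adj v x := Subtype.prop
  rcases x with x | x <;> rcases y with y | y
  · simpa [e', e] using hmid _ _ (hN _) (hN _)
  · simpa [e', e] using hcross _ _ (hN _) (hN' _)
  · simpa [e', e] using (hcross _ _ (hN _) (hN' _)).symm
  · simpa [e', e] using hfar _ _ (hN' _) (hN' _)

/-! ### Complete graphs, complete bipartite graphs and cycles -/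

/-- Vertices with the same neighbours, apart from each other, have the same distance to every third
vertex. -/
theorem Connected.dist_eq_of_twins (hG : G.Connected) {u v w : V}
    (h : ∀ x, x ≠ u → x ≠ v → (G.Adj u x ↔ G.Adj v x)) (hu : w ≠ u) (hv : w ≠ v) :
    G.dist u w = G.dist v w := by
  have key : ∀ {u v : V}, (∀ x, x ≠ u → x ≠ v → (G.Adj u x ↔ G.Adj v x)) → w ≠ u →
      G.dist v w ≤ G.dist u w := by
    intro u v h hu
    obtain ⟨p, hp⟩ := hG.exists_walk_length_eq_dist u w
    cases p with
    | nil => exact absurd rfl hu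
    | @cons _ a _ hua p =>
      rw [← hp, Walk.length_cons]
      by_cases hav : a = v
      · subst hav
        exact (dist_le p).trans (Nat.le_succ _)
      · exact dist_le (.cons ((h a hua.ne' hav).mp hua) p)
  exact le_antisymm (key (fun x h₁ h₂ ↦ (h x h₂ h₁).symm) hv) (key h hu)

theorem Connected.mem_or_mem_of_twins (hG : G.Connected) {W : Set V} (hW : G.IsResolvingSet W)
    {u v : V} (huv : u ≠ v) (h : ∀ x, x ≠ u → x ≠ v → (G.Adj u x ↔ G.Adj v x)) :
    u ∈ W ∨ v ∈ W := by
  by_contra! hno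
  obtain ⟨w, hw, hd⟩ := hW u v huv
  exact hd (hG.dist_eq_of_twins h (fun e ↦ hno.1 (e ▸ hw)) (fun e ↦ hno.2 (e ▸ hw)))

theorem Connected.card_le_metricDimension_add_one [Fintype V] (hG : G.Connected)
    (φ : G ≃g (⊤ : SimpleGraph (Fin (Fintype.card V)))) :
    Fintype.card V ≤ G.metricDimension + 1 := by
  classical
  have hadj : ∀ x y, G.Adj x y ↔ x ≠ y := fun x y ↦ by rw [← φ.map_adj_iff]; simp
  have := le_metricDimension hG (k := Fintype.card V - 1) (fun W hW ↦ by
    have : (Wᶜ).card ≤ 1 := Finset.card_le_one.mpr fun a ha b hb ↦ by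
      by_contra hab
      have := hG.mem_or_mem_of_twins hW hab (fun x h₁ h₂ ↦ by simp [hadj, h₁.symm, h₂.symm])
      simp_all
    have := W.card_add_card_compl
    omega)
  omega

theorem adj_iff_isLeft_ne_of_iso_completeBipartiteGraph {r s : ℕ}
    (φ : G ≃g completeBipartiteGraph (Fin r) (Fin s)) (x y : V) :
    G.Adj x y ↔ (φ x).isLeft ≠ (φ y).isLeft := by
  rw [← φ.map_adj_iff]
  rcases φ x with a | a <;> rcases φ y with b | b <;> simp

/-- Vertices on the same side are twins, so at most one vertex of each side is not a landmark. -/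
theorem Connected.card_le_metricDimension_add_two [Fintype V] (hG : G.Connected) {r s : ℕ}
    (φ : G ≃g completeBipartiteGraph (Fin r) (Fin s)) :
    Fintype.card V ≤ G.metricDimension + 2 := by
  classical
  have hadj := adj_iff_isLeft_ne_of_iso_completeBipartiteGraph φ
  have := le_metricDimension hG (k := Fintype.card V - 2) (fun W hW ↦ by
    have hinj : Set.InjOn (fun x ↦ (φ x).isLeft) (Wᶜ : Finset V) := fun a ha b hb he ↦ by
      by_contra hab
      have := hG.mem_or_mem_of_twins hW hab (fun x _ _ ↦ by
        rw [hadj, hadj]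
        exact not_congr (by rw [show (φ a).isLeft = (φ b).isLeft from he]))
      simp_all
    have : (Wᶜ).card ≤ 2 := by
      rw [← Finset.card_image_of_injOn hinj]
      exact (Finset.card_le_univ _).trans (by simp)
    have := W.card_add_card_compl
    omega)
  omega

theorem three_lt_girth_of_iso_completeBipartiteGraph {r s : ℕ}
    (φ : G ≃g completeBipartiteGraph (Fin r) (Fin s))
    (hcyc : ∃ (v : V) (c : G.Walk v v), c.IsCycle) : 3 < G.girth := by
  obtain ⟨v, c, hc, hg⟩ := exists_girth_eq_length.mpr
    (fun h : G.IsAcyclic ↦ hcyc.elim fun v ⟨c, hc⟩ ↦ h c hc)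
  have hadj := adj_iff_isLeft_ne_of_iso_completeBipartiteGraph φ
  by_contra hle
  have := hc.three_le_length
  have h3 : c.length = 3 := by omega
  have h₁ := c.adj_getVert_succ (i := 0) (by omega)
  have h₂ := c.adj_getVert_succ (i := 1) (by omega)
  have h₃ := c.adj_getVert_succ (i := 2) (by omega)
  rw [c.getVert_of_length_le (i := 2 + 1) (by omega)] at h₃
  rw [c.getVert_zero] at h₁
  rw [hadj] at h₁ h₂ h₃
  grind

/-- A cycle that is not spanning would have a vertex of degree at least three. -/
theorem Connected.card_le_girth_of_iso_cycleGraph [Fintype V] (hG : G.Connected)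
    (hcyc : ∃ (v : V) (c : G.Walk v v), c.IsCycle) {n : ℕ} (hn : 3 ≤ n)
    (φ : G ≃g cycleGraph n) : Fintype.card V ≤ G.girth := by
  classical
  obtain ⟨k, rfl⟩ := Nat.exists_eq_add_of_le' hn
  obtain ⟨v, c, hc, hg, hall | ⟨x, hx, hvx⟩⟩ := hG.exists_girth_cycle hcyc
  · have : (Finset.univ : Finset V) ⊆ (Finset.range c.length).image c.getVert := fun x _ ↦ by
      obtain ⟨i, rfl, hi⟩ := Walk.mem_support_iff_exists_getVert.mp (hall x)
      have := hc.three_le_length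
      obtain hi | rfl := hi.lt_or_eq
      · exact Finset.mem_image_of_mem _ (by simpa using hi)
      · exact Finset.mem_image.mpr ⟨0, by simp; omega, by simp⟩
    have := (Finset.card_le_card this).trans Finset.card_image_le
    simpa [hg] using this
  · have h3 : ({φ x, φ c.snd, φ c.penultimate} : Finset (Fin (k + 3))).card = 3 := by
      have h₁ : x ≠ c.snd := fun h ↦ hx (h ▸ c.getVert_mem_support _)
      have h₂ : x ≠ c.penultimate := fun h ↦ hx (h ▸ c.getVert_mem_support _)
      exact Finset.card_eq_three.mpr ⟨_, _, _, φ.injective.ne h₁, φ.injective.ne h₂,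
        φ.injective.ne hc.snd_ne_penultimate, rfl⟩
    have hsub : ({φ x, φ c.snd, φ c.penultimate} : Finset (Fin (k + 3))) ⊆
        (cycleGraph (k + 3)).neighborFinset (φ v) := by
      intro y hy
      simp only [Finset.mem_insert, Finset.mem_singleton] at hy
      rw [mem_neighborFinset]
      rcases hy with rfl | rfl | rfl
      · exact φ.map_adj_iff.mpr hvx
      · exact φ.map_adj_iff.mpr (c.adj_snd hc.not_nil)
      · exact φ.map_adj_iff.mpr (c.adj_penultimate hc.not_nil).symm
    have := Finset.card_le_card hsub
    rw [h3, card_neighborFinset_eq_degree, cycleGraph_degree_three_le] at this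
    omega

/-- A single landmark does not resolve two of its own neighbours. -/
theorem Connected.two_le_metricDimension [Fintype V] (hG : G.Connected)
    (h : ∀ v, ∃ a b, a ≠ b ∧ G.Adj a v ∧ G.Adj b v) : 2 ≤ G.metricDimension := by
  refine le_metricDimension hG (fun W hW ↦ ?_)
  by_contra hlt
  obtain ⟨v⟩ := hG.nonempty
  obtain ⟨w, hw⟩ : ∃ w, ∀ x ∈ W, x = w := by
    rcases W.eq_empty_or_nonempty with rfl | ⟨w, hw⟩
    · exact ⟨v, by simp⟩
    · exact ⟨w, fun x hx ↦ Finset.card_le_one.mp (by omega) x hx w hw⟩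
  obtain ⟨a, b, hab, ha, hb⟩ := h w
  obtain ⟨x, hx, hne⟩ := hW a b hab
  obtain rfl := hw x hx
  rw [dist_eq_one_iff_adj.mpr ha, dist_eq_one_iff_adj.mpr hb] at hne
  exact hne rfl

theorem exists_ne_adj_adj_of_iso_cycleGraph {n : ℕ} (hn : 3 ≤ n) (φ : G ≃g cycleGraph n) (v : V) :
    ∃ a b, a ≠ b ∧ G.Adj a v ∧ G.Adj b v := by
  obtain ⟨k, rfl⟩ := Nat.exists_eq_add_of_le' hn
  obtain ⟨a, b, hab, h⟩ := Finset.card_eq_two.mp (cycleGraph_degree_three_le (v := φ v))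
  have key : ∀ c ∈ (cycleGraph (k + 3)).neighborFinset (φ v), G.Adj (φ.symm c) v := fun c hc ↦ by
    rw [mem_neighborFinset] at hc
    rw [← φ.map_adj_iff, φ.apply_symm_apply]
    exact hc.symm
  exact ⟨φ.symm a, φ.symm b, φ.symm.injective.ne hab, key a (by simp [h]), key b (by simp [h])⟩

end SimpleGraph

theorem theorem2p5 {V : Type*} [Fintype V] (G : SimpleGraph V)
    (hconn : G.Connected) (hcycle : ∃ (v : V) (c : G.Walk v v), c.IsCycle) :
    (G.metricDimension : ℤ) = (Fintype.card V : ℤ) - (G.girth : ℤ) + 2 ↔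
      (3 ≤ Fintype.card V ∧ Nonempty (G ≃g SimpleGraph.cycleGraph (Fintype.card V))) ∨
      (3 ≤ Fintype.card V ∧ Nonempty (G ≃g (⊤ : SimpleGraph (Fin (Fintype.card V))))) ∨
      (∃ r s : ℕ, 2 ≤ r ∧ 2 ≤ s ∧
        Nonempty (G ≃g completeBipartiteGraph (Fin r) (Fin s))) := by
  classical
  have hupper := hconn.metricDimension_add_girth_le hcycle
  obtain ⟨v, c, hc, hg, hout⟩ := hconn.exists_girth_cycle hcycle
  have hl := hc.three_le_length
  have hcard : 3 ≤ Fintype.card V := by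
    have := hc.support_nodup.length_le_card
    rw [List.length_tail, SimpleGraph.Walk.length_support] at this
    omega
  constructor
  · intro h
    have h : G.metricDimension + G.girth = Fintype.card V + 2 := by omega
    rcases hout with hall | ⟨x, hx, hvx⟩
    · exact .inl ⟨hcard, hc.nonempty_iso_cycleGraph hg hall⟩
    obtain h3 | h4 | h5 : G.girth = 3 ∨ G.girth = 4 ∨ 4 < G.girth := by omega
    · obtain rfl := hconn.eq_top_of_card_lt_metricDimension_add_two (by omega)
      exact .inr (.inl ⟨hcard, ⟨SimpleGraph.Iso.completeGraph (Fintype.equivFin V)⟩⟩)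
    · have hadj := fun j hj ↦ hc.adj_start_getVert_iff hg (j := j) hj
      refine .inr (.inr (SimpleGraph.nonempty_iso_completeBipartiteGraph (by omega)
        (fun _ _ _ ↦ hconn.not_adj_trans (by omega) (by omega)) (v := v)
        ((hadj 1 (by omega)).mpr (by omega)) ((hadj 3 (by omega)).mpr (by omega)) ?_
        (fun h ↦ by have := (hadj 2 (by omega)).mp h; omega) ?_))
      · rw [Ne, hc.getVert_inj_of_lt (by omega) (by omega)]
        omega
      · intro h
        have := (hc.getVert_inj_of_lt (i := 0) (by omega) (by omega)).mp (c.getVert_zero.trans h)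
        omega
    · have := hconn.metricDimension_add_girth_le_of_notMem h5 hc hg hx hvx
      omega
  · rintro (⟨hn, ⟨φ⟩⟩ | ⟨-, ⟨φ⟩⟩ | ⟨r, s, -, -, ⟨φ⟩⟩)
    · have := hconn.card_le_girth_of_iso_cycleGraph hcycle hn φ
      have := hconn.two_le_metricDimension (SimpleGraph.exists_ne_adj_adj_of_iso_cycleGraph hn φ)
      omega
    · have := hconn.card_le_metricDimension_add_one φ
      omega
    · have := hconn.card_le_metricDimension_add_two φ
      have := SimpleGraph.three_lt_girth_of_iso_completeBipartiteGraph φ hcycle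
      omega
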